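/- **Lemma (Deliver Condition 1 of APM-BRB satisfies Agreement).** Let $n=3f+1$ and let a static adversary corrupt a fixed set of exactly $f$ of the nodes $P_1,\dots,P_n$; the other $2f+1$ nodes are honest. The nodes run APM-BRB with committee size $n_c$ and chain length $\varphi$ over an asynchronous network (messages may be delayed arbitrarily and scheduled in any way), with unforgeable signatures and a collision-free hash: - The committee $N_c(i,r)$ of sender $P_i$ for round $r$ is drawn with the hash function from $(\mathrm{seed}_0, r \bmod \varphi, i)$. A certificate $\mathrm{cert}(m)$ for a message $m$ of $P_i$ for round $r$ is a threshold signature on $m$ by at least $\lfloor n_c/2\rfloor+1$ members of $N_c(i,r)$. - The message $m_r^i$ of an honest sender $P_i$ for round $r\ge 2$ contains $\mathrm{cert}(m_{r-1}^i)$, certificates $\mathrm{prev}\{\}$ of round-$(r-1)$ messages of $2f+1$ distinct nodes, and an array $\mathrm{triggers}[]$ of the certificates that triggered deliveries. - Every honest node keeps, for each sender $P_i$, an append-only list $\mathrm{promises}[i]$ of messages of $P_i$ for rounds $1,2,\dots$, each containing the valid certificate of the one before. An honest committee member signs at most one message of $P_i$ for round $r$, the first that it receives; for $r\ge 2$ it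 does so only if that message contains the valid certificate of the entry $\mathrm{promises}[i][r-1]$, after fetching the missing entries. - *Deliver Condition 1*: when an honest node obtains $\mathrm{cert}(m_r^i)$ with $r\ge\varphi$, from signature shares, from $P_i$, or from $\mathrm{triggers}[]$ of a message that it has delivered, it follows the chain of certificates $m_r^i, m_{r-1}^i,\dots$ backwards and calls $\textsc{Deliver}_i(m_u^i,u)$ for $u=r-\varphi, r-\varphi-1,\dots,1$, unless it has already delivered a message of $P_i$ for round $u$. (*Deliver Condition 2* delivers $m_{r-1}^i$ and its predecessors when $\mathrm{cert}(m_{r-1}^i)$ lies in $\mathrm{prev}\{\}$ of certified round-$r$ messages of all $n$ nodes, or of $2f+1$ delivered round-$r$ messages of distinct senders.) Consider the following two assumptions on an execution. 1. Every committee has a majority of honest nodes. 2. For all $i$ and $r\ge 1$ and every chain of messages $m_r,m_{r+1},\dots,m_{r+\varphi}$ of $P_i$ for the rounds $r,\dots,r+\varphi$, each of which gets certified and each of which, except $m_r$, contains the certificate of the one before, at least $f+1$ distinct honest nodes sign at least one of $m_{r+1},\dots,m_{r+\varphi}$. Then in every execution that satisfies 1 and 2, Deliver Condition 1 satisfies Agreement: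 if honest nodes call $\textsc{Deliver}_i(m',r)$ and $\textsc{Deliver}_i(m'',r)$ by Deliver Condition 1, then $m'=m''$. Consequently, for every random execution (random seed, schedule and adversary) in which 1 and 2 hold with probability at least $1-\varepsilon$, Deliver Condition 1 satisfies Agreement with probability at least $1-\varepsilon$. -/

import Mathlib

open MeasureTheory

namespace APMBRB

universe u v

/-! Ideal (symbolic) cryptography.  A certificate `cert(m)` is a term that determines the signed
message `m` (no hash collisions); whether it is a valid threshold signature is decided by the
signature shares that have actually been generated (no forgeries), see `CertValid`. -/

/-- The certificate `cert(m)` of a message `m = signed`. -/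
structure Cert (M : Type u) : Type u where
  signed : M

/-- The message `m_r^i` of sender `i` for round `r`: content, the certificate of the sender's
message of the previous round (if any), the certificates `prev{}` of messages of the previous round
and the array `triggers[]` of pairs (certificate, round). -/
inductive Msg (C : Type u) (n : ℕ) : Type u where
  | mk (content : C) (sender : Fin n) (round : ℕ) (prevCert : Option (Cert (Msg C n)))
      (prev : List (Cert (Msg C n))) (triggers : Fin n → Option (Cert (Msg C n) × ℕ)) : Msg C n

namespace Msg

def sender {C : Type u} {n : ℕ} : Msg C n → Fin n
  | mk _ i _ _ _ _ => i

def round {C : Type u} {n : ℕ} : Msg C n → ℕ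
  | mk _ _ r _ _ _ => r

def prevCert {C : Type u} {n : ℕ} : Msg C n → Option (Cert (Msg C n))
  | mk _ _ _ c _ _ => c

def prev {C : Type u} {n : ℕ} : Msg C n → List (Cert (Msg C n))
  | mk _ _ _ _ p _ => p

def triggers {C : Type u} {n : ℕ} : Msg C n → Fin n → Option (Cert (Msg C n) × ℕ)
  | mk _ _ _ _ _ t => t

end Msg

/-- The parameters of a run: the resilience parameter `f`, the committee size `nc`, the period (and
chain length) `φ`, the hash function on sequences of numbers, the seed handed out by the dealer, and
the set of nodes that the static adversary has corrupted. -/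
structure Config (n : ℕ) where
  f : ℕ
  nc : ℕ
  φ : ℕ
  hash : List ℕ → ℕ
  seed₀ : ℕ
  corrupt : Finset (Fin n)

/-- `k` draws: map the seed to a node index, then hash the seed for the next draw. -/
def drawCommittee {n : ℕ} (hash : List ℕ → ℕ) (hn : 0 < n) : ℕ → ℕ → Finset (Fin n)
  | 0, _ => ∅
  | k + 1, seed => insert ⟨seed % n, Nat.mod_lt _ hn⟩ (drawCommittee hash hn k (hash [seed]))

/-- The committee of sender `i` for round `r`; it repeats every `φ` rounds. -/
def sampleCommittee {n : ℕ} (P : Config n) (i : Fin n) (r : ℕ) : Finset (Fin n) :=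
  drawCommittee P.hash i.pos P.nc (P.hash [P.seed₀, r % P.φ, i.val + 1])

/-- The two ways in which a message can be delivered. -/
inductive Cond where
  | one
  | two

/-- A running delivery procedure: starting from the certificate `cert` for round `start` of
`sender`, walk back along the chain of certificates and deliver the messages of the rounds
`top, top - 1, …, 1`. -/
structure Task (C : Type u) (n : ℕ) where
  cond : Cond
  sender : Fin n
  start : ℕ
  top : ℕ
  cert : Cert (Msg C n)

/-- One call of `Deliver_sender(msg, round)`, with the condition that caused it. -/
structure Delivery (C : Type u) (n : ℕ) where
  cond : Cond
  sender : Fin n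
  round : ℕ
  msg : Msg C n

/-- Local memory of a node.  Entry `k` of the list `promises j` is the message of `P_j` for round
`k + 1`.  `sent` lists the node's own messages (entry `k` for round `k + 1`), and `received` holds
the proposals that it did not ignore. -/
structure NodeState (C : Type u) (n : ℕ) where
  promises : Fin n → List (Msg C n)
  triggers : Fin n → Option (Cert (Msg C n) × ℕ)
  sent : List (Msg C n)
  received : Set (Msg C n)
  tasks : Set (Task C n)
  delivered : Set (Delivery C n)

/-- What a packet can carry: a broadcast message, a signature share on a message, a certificate, a
request for the message of `i` for round `r`, or a message sent on request. -/
inductive Payload (C : Type u) (n : ℕ) : Type u where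
  | proposal (m : Msg C n)
  | share (m : Msg C n)
  | certificate (c : Cert (Msg C n))
  | request (i : Fin n) (r : ℕ)
  | supply (m : Msg C n)

/-- A packet on an authenticated point-to-point channel. -/
structure Packet (C : Type u) (n : ℕ) where
  src : Fin n
  dst : Fin n
  load : Payload C n

/-- Global state: local memories, all packets sent so far (delivered with arbitrary delay and in
arbitrary order), and all signature shares `(j, m)`, i.e. `⟨m⟩_j`, generated so far. -/
structure State (C : Type u) (n : ℕ) where
  node : Fin n → NodeState C n
  net : Set (Packet C n)
  shares : Set (Fin n × Msg C n)

def NodeState.init (C : Type u) (n : ℕ) : NodeState C n where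
  promises := fun _ => []
  triggers := fun _ => none
  sent := []
  received := ∅
  tasks := ∅
  delivered := ∅

def State.init (C : Type u) (n : ℕ) : State C n where
  node := fun _ => NodeState.init C n
  net := ∅
  shares := ∅

section Protocol

variable {C : Type u} {n : ℕ}

def Honest (P : Config n) (p : Fin n) : Prop := p ∉ P.corrupt

/-- `cert(m)` is a valid `(nc/2 + 1, N_c)` threshold signature, `N_c` being the committee of the
sender and the round of `m`: at least `nc/2 + 1` members of `N_c` have generated a share on `m`. -/
def CertValid (P : Config n) (s : State C n) (c : Cert (Msg C n)) : Prop :=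
  ∃ J : Finset (Fin n), J ⊆ sampleCommittee P c.signed.sender c.signed.round ∧
    P.nc / 2 + 1 ≤ J.card ∧ ∀ j ∈ J, (j, c.signed) ∈ s.shares

/-- Node `p` has obtained the certificate of `m`: it has received valid shares from `nc/2 + 1`
distinct members of the committee, or the valid certificate from the sender of `m`. -/
def HasCert (P : Config n) (s : State C n) (p : Fin n) (m : Msg C n) : Prop :=
  (∃ J : Finset (Fin n), J ⊆ sampleCommittee P m.sender m.round ∧ P.nc / 2 + 1 ≤ J.card ∧
      ∀ j ∈ J, (⟨j, p, .share m⟩ : Packet C n) ∈ s.net ∧ (j, m) ∈ s.shares) ∨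
    ((⟨m.sender, p, .certificate ⟨m⟩⟩ : Packet C n) ∈ s.net ∧ CertValid P s ⟨m⟩)

/-- Node `p` has received `m` from a member of the committee of the sender and the round of `m`. -/
def ObtainedFromCommittee (P : Config n) (s : State C n) (p : Fin n) (m : Msg C n) : Prop :=
  ∃ q ∈ sampleCommittee P m.sender m.round, (⟨q, p, .supply m⟩ : Packet C n) ∈ s.net

/-- `m` is stored by a node with local memory `ns`. -/
def Holds (ns : NodeState C n) (m : Msg C n) : Prop :=
  m ∈ ns.sent ∨ m ∈ ns.received ∨ m ∈ ns.promises m.sender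

/-- `m` extends the chain `chain` of messages of rounds `1, …, m.round - 1`: either `m` is for
round `1`, or the certificate in `m` is the valid certificate of the message `m'` of
`chain` for round `m.round - 1`. -/
def Extends (P : Config n) (s : State C n) (chain : List (Msg C n)) (m : Msg C n) : Prop :=
  m.round = 1 ∨ (2 ≤ m.round ∧ ∃ m' : Msg C n, chain[m.round - 2]? = some m' ∧
    m.prevCert = some ⟨m'⟩ ∧ CertValid P s ⟨m'⟩)

/-- The node has called `Deliver_i(·, r)`. -/
def HasDelivered (ns : NodeState C n) (i : Fin n) (r : ℕ) : Prop :=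
  ∃ (k : Cond) (m : Msg C n), (⟨k, i, r, m⟩ : Delivery C n) ∈ ns.delivered

/-- The new content of a cell of `triggers[]` when a certificate `c` for round `r` is processed. -/
def newTrigger (old : Option (Cert (Msg C n) × ℕ)) (c : Cert (Msg C n)) (r : ℕ) :
    Option (Cert (Msg C n) × ℕ) :=
  match old with
  | none => some (c, r)
  | some (c', r') => if r' < r then some (c, r) else some (c', r')

/-- Start of `processCertificate(i, r, c)`; the deliveries of the new task are separate steps. -/
def processCertificate (P : Config n) (ns : NodeState C n) (i : Fin n) (r : ℕ)
    (c : Cert (Msg C n)) : NodeState C n :=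
  if P.φ ≤ r then
    { ns with
      triggers := Function.update ns.triggers i (newTrigger (ns.triggers i) c r)
      tasks := insert ⟨.one, i, r, r - P.φ, c⟩ ns.tasks }
  else ns

/-- The reaction to `Deliver(m, ·)`: process every certificate in `triggers[]` of `m`. -/
def processTriggers (P : Config n) (ns : NodeState C n) (m : Msg C n) : NodeState C n :=
  (List.finRange n).foldl (fun ns j =>
    match m.triggers j with
    | none => ns
    | some (c, r) => processCertificate P ns j r c) ns

/-- `c` is the chain of messages of sender `i` for the rounds `a, …, b` that node `p` finds when it
walks back from the certificate `top` for round `b` to round `a`. -/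
def WalkBack (P : Config n) (s : State C n) (p : Fin n) (i : Fin n) (a b : ℕ)
    (top : Cert (Msg C n)) (c : ℕ → Msg C n) : Prop :=
  top = ⟨c b⟩ ∧
  (∀ k, a ≤ k → k ≤ b → (c k).sender = i ∧ (c k).round = k ∧ CertValid P s ⟨c k⟩ ∧
    ObtainedFromCommittee P s p (c k)) ∧
  (∀ k, a < k → k ≤ b → (c k).prevCert = some ⟨c (k - 1)⟩)

/-- Replace the local memory of `p`. -/
def State.setNode (s : State C n) (p : Fin n) (ns : NodeState C n) : State C n :=
  { s with node := Function.update s.node p ns }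

/-- Put packets on the network. -/
def State.post (s : State C n) (A : Set (Packet C n)) : State C n :=
  { s with net := s.net ∪ A }

/-- Packets with load `x` from `p` to all nodes of `N`. -/
def multicast (p : Fin n) (N : Finset (Fin n)) (x : Payload C n) : Set (Packet C n) :=
  {y | ∃ q ∈ N, y = ⟨p, q, x⟩}

/-- The atomic steps of the protocol and of the adversary. -/
inductive Step (P : Config n) (s : State C n) : State C n → Prop where
  /-- A corrupted node sends anything to anyone. -/
  | byzSend (b q : Fin n) (x : Payload C n) (hb : ¬ Honest P b) :
      Step P s (s.post {⟨b, q, x⟩})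
  /-- A corrupted node generates a signature share on anything. -/
  | byzSign (b : Fin n) (m : Msg C n) (hb : ¬ Honest P b) :
      Step P s { s with shares := insert (b, m) s.shares }
  /-- Broadcast of the first message. -/
  | sendFirst (p : Fin n) (x : C) (m : Msg C n) (hp : Honest P p)
      (hsent : (s.node p).sent = [])
      (hm : m = .mk x p 1 none [] (s.node p).triggers) :
      Step P s ((s.setNode p { s.node p with sent := [m] }).post
        (multicast p (sampleCommittee P p 1) (.proposal m)))
  /-- Broadcast of the message for round `r ≥ 2`: the certificate of the node's own previous message
  `m₀` and the certificates of `promises[j][r - 1]` for `2f + 1` nodes `j` are at hand. -/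
  | sendNext (p : Fin n) (x : C) (r : ℕ) (m₀ m : Msg C n) (js : List (Fin n))
      (w : Fin n → Msg C n) (hp : Honest P p)
      (hr : 2 ≤ r) (hlen : (s.node p).sent.length = r - 1)
      (hlast : (s.node p).sent[r - 2]? = some m₀) (hcert : HasCert P s p m₀)
      (hjs : js.Nodup) (hjs' : js.length = 2 * P.f + 1)
      (hw : ∀ j ∈ js, ((s.node p).promises j)[r - 2]? = some (w j) ∧ HasCert P s p (w j))
      (hm : m = .mk x p r (some ⟨m₀⟩) (js.map fun j => ⟨w j⟩) (s.node p).triggers) :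
      Step P s ((s.setNode p { s.node p with sent := (s.node p).sent ++ [m] }).post
        (multicast p (sampleCommittee P p r) (.proposal m)))
  /-- A committee member receives a broadcast message, from its sender or re-sent by a committee
  member, and does not ignore it. -/
  | receive (p q : Fin n) (m : Msg C n) (hp : Honest P p)
      (hpk : (⟨q, p, .proposal m⟩ : Packet C n) ∈ s.net)
      (hq : q = m.sender ∨ q ∈ sampleCommittee P m.sender m.round)
      (hr : 1 ≤ m.round) (hmem : p ∈ sampleCommittee P m.sender m.round)
      (hfirst : ∀ m' ∈ (s.node p).received, m'.sender = m.sender → m'.round = m.round → m' = m) :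
      Step P s (s.setNode p { s.node p with received := insert m (s.node p).received })
  /-- One iteration of `syncMsg`, run on behalf of a received message `m'` of a later round: the
  next entry of `promises` is fetched from the committee. -/
  | sync (p : Fin n) (m m' : Msg C n) (hp : Honest P p)
      (hm' : m' ∈ (s.node p).received) (hsender : m'.sender = m.sender)
      (hround : m.round < m'.round)
      (hnext : m.round = ((s.node p).promises m.sender).length + 1)
      (hext : Extends P s ((s.node p).promises m.sender) m)
      (hobt : ObtainedFromCommittee P s p m) :
      Step P s (s.setNode p { s.node p with
        promises := Function.update (s.node p).promises m.sender
          ((s.node p).promises m.sender ++ [m]) })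
  /-- One iteration of `reqMsg`, run in order to send the message of the next round: the next entry
  of `promises` is fetched from its sender, the last one together with its own certificate. -/
  | req (p : Fin n) (m : Msg C n) (hp : Honest P p)
      (hround : m.round ≤ (s.node p).sent.length)
      (hnext : m.round = ((s.node p).promises m.sender).length + 1)
      (hext : Extends P s ((s.node p).promises m.sender) m)
      (hobt : (⟨m.sender, p, .supply m⟩ : Packet C n) ∈ s.net)
      (hcert : m.round = (s.node p).sent.length → HasCert P s p m) :
      Step P s (s.setNode p { s.node p with
        promises := Function.update (s.node p).promises m.sender
          ((s.node p).promises m.sender ++ [m]) })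
  /-- A received message that extends the chain in `promises` (`syncMsg` has returned) is re-sent
  to the committee and signed, and the share is sent to all nodes. -/
  | sign (p : Fin n) (m : Msg C n) (hp : Honest P p) (hm : m ∈ (s.node p).received)
      (hext : Extends P s ((s.node p).promises m.sender) m) :
      Step P s (({ s with shares := insert (p, m) s.shares } : State C n).post
        (multicast p (sampleCommittee P m.sender m.round) (.proposal m) ∪
          multicast p Finset.univ (.share m)))
  /-- A request for a message and (if the recipient is its sender) its certificate. -/
  | request (p q : Fin n) (i : Fin n) (r : ℕ) (hp : Honest P p) :
      Step P s (s.post {⟨p, q, .request i r⟩})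
  /-- The answer to a request by a node that stores the message. -/
  | supply (p q : Fin n) (m : Msg C n) (hp : Honest P p)
      (hreq : (⟨q, p, .request m.sender m.round⟩ : Packet C n) ∈ s.net)
      (hm : Holds (s.node p) m) :
      Step P s (s.post {⟨p, q, .supply m⟩})
  /-- A sender that has obtained the certificate of one of its own messages hands it out. -/
  | sendCert (p q : Fin n) (m : Msg C n) (hp : Honest P p) (hm : m ∈ (s.node p).sent)
      (hcert : HasCert P s p m) :
      Step P s (s.post {⟨p, q, .certificate ⟨m⟩⟩})
  /-- Deliver Condition 1: a certificate has been obtained and is processed. -/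
  | startOne (p : Fin n) (m : Msg C n) (hp : Honest P p) (hcert : HasCert P s p m) :
      Step P s (s.setNode p (processCertificate P (s.node p) m.sender m.round ⟨m⟩))
  /-- Deliver Condition 2, first part: the messages of all nodes for round `r`, with certificates,
  have been obtained, and all of them contain the certificate `c` in `prev{}`. -/
  | startTwo (p : Fin n) (r : ℕ) (w : Fin n → Msg C n) (c : Cert (Msg C n)) (hp : Honest P p)
      (hr : 2 ≤ r)
      (hw : ∀ j, (w j).sender = j ∧ (w j).round = r ∧ HasCert P s p (w j) ∧
        ObtainedFromCommittee P s p (w j) ∧ c ∈ (w j).prev)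
      (hc : c.signed.round = r - 1) :
      Step P s (s.setNode p { s.node p with
        tasks := insert ⟨.two, c.signed.sender, r - 1, r - 1, c⟩ (s.node p).tasks })
  /-- Deliver Condition 2, second part: messages of `2f + 1` nodes for round `r` have been
  delivered, and all of them contain the certificate `c` in `prev{}`. -/
  | startTwo' (p : Fin n) (r : ℕ) (J : Finset (Fin n)) (w : Fin n → Msg C n)
      (c : Cert (Msg C n)) (hp : Honest P p) (hr : 2 ≤ r) (hJ : J.card = 2 * P.f + 1)
      (hw : ∀ j ∈ J, (∃ k : Cond, (⟨k, j, r, w j⟩ : Delivery C n) ∈ (s.node p).delivered) ∧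
        c ∈ (w j).prev)
      (hc : c.signed.round = r - 1) :
      Step P s (s.setNode p { s.node p with
        tasks := insert ⟨.two, c.signed.sender, r - 1, r - 1, c⟩ (s.node p).tasks })
  /-- The next delivery of a running task, unless there has been one for this sender and round; the
  certificates in `triggers[]` of the delivered message are then processed. -/
  | deliver (p : Fin n) (T : Task C n) (r : ℕ) (c : ℕ → Msg C n) (hp : Honest P p)
      (hT : T ∈ (s.node p).tasks) (hr : 1 ≤ r) (hrT : r ≤ T.top)
      (hwalk : WalkBack P s p T.sender r T.start T.cert c)
      (habove : ∀ k, r < k → k ≤ T.top → HasDelivered (s.node p) T.sender k)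
      (hnew : ¬ HasDelivered (s.node p) T.sender r) :
      Step P s (s.setNode p (processTriggers P
        { s.node p with
          delivered := insert ⟨T.cond, T.sender, r, c r⟩ (s.node p).delivered } (c r)))

/-- An execution of APM-BRB: a sequence of states from the initial one, each obtained from the one
before by a step or by idling. -/
def IsExecution (P : Config n) (E : ℕ → State C n) : Prop :=
  E 0 = State.init C n ∧ ∀ t, E (t + 1) = E t ∨ Step P (E t) (E (t + 1))

/-- Every committee has a majority of honest nodes. -/
def HonestMajority (P : Config n) : Prop :=
  ∀ (i : Fin n) (r : ℕ), 1 ≤ r →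
    (sampleCommittee P i r).card < 2 * (sampleCommittee P i r \ P.corrupt).card

/-- `c r, …, c (r + φ)` is a chain of messages of sender `i` for the rounds `r, …, r + φ`, each of
which gets certified in the execution and, except for the first, contains the certificate of
the one before. -/
def IsCertifiedChain (P : Config n) (E : ℕ → State C n) (i : Fin n) (r : ℕ)
    (c : ℕ → Msg C n) : Prop :=
  (∀ k, r ≤ k → k ≤ r + P.φ → (c k).sender = i ∧ (c k).round = k ∧
    ∃ t, CertValid P (E t) ⟨c k⟩) ∧
  (∀ k, r < k → k ≤ r + P.φ → (c k).prevCert = some ⟨c (k - 1)⟩)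

/-- For every certified chain over `φ` rounds, at least `f + 1` distinct honest nodes sign at least
one of the messages of the chain after its first one. -/
def EnoughHonestSigners (P : Config n) (E : ℕ → State C n) : Prop :=
  ∀ (i : Fin n) (r : ℕ) (c : ℕ → Msg C n), 1 ≤ r → IsCertifiedChain P E i r c →
    ∃ S : Finset (Fin n), P.f + 1 ≤ S.card ∧ ∀ p ∈ S, Honest P p ∧
      ∃ k, r < k ∧ k ≤ r + P.φ ∧ ∃ t, (p, c k) ∈ (E t).shares

/-- Agreement of Deliver Condition 1: honest nodes never deliver, by this condition, different
messages for the same sender and round. -/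
def AgreementOne (P : Config n) (E : ℕ → State C n) : Prop :=
  ∀ (p q : Fin n), Honest P p → Honest P q → ∀ (t t' : ℕ) (i : Fin n) (r : ℕ) (m m' : Msg C n),
    (⟨.one, i, r, m⟩ : Delivery C n) ∈ ((E t).node p).delivered →
    (⟨.one, i, r, m'⟩ : Delivery C n) ∈ ((E t').node q).delivered → m = m'

end Protocol

/-- The property `A` holds with probability at least `a`: it holds on an event of probability at
least `a`. -/
def HoldsWithProb {Ω : Type v} [MeasurableSpace Ω] (μ : Measure Ω) (a : ℝ) (A : Ω → Prop) : Prop :=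
  ∃ G : Set Ω, MeasurableSet G ∧ a ≤ μ.real G ∧ ∀ ω ∈ G, A ω

end APMBRB

namespace APMBRB

section Protocol

variable {C : Type*} {n : ℕ} {P : Config n}

/-! Let `m` be delivered for sender `i` and round `r` by Deliver Condition 1. The walk that reaches
`m` starts at least `φ` rounds later, so it exhibits a certified chain for the rounds `r, …, r + φ`
that begins with `m` (`IsExecution.startsChain_of_delivered`). By `EnoughHonestSigners`, `f + 1`
honest nodes sign a later message of this chain. An honest node signs only a message that extends
its own list `promises i`, and each entry of that list contains the certificate of the one before.
Certificates determine messages, so the list of each signer agrees with the chain back to round `r`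
and has `m` at index `r - 1` (`IsExecution.promises_of_signed`).

A second delivery, of `m'`, gives another `f + 1` honest nodes with `m'` at that index. There are at
most `2f + 1` honest nodes, so some node belongs to both sets. Its list is append-only and has one
entry per index, hence `m = m'`.

The ingredients are invariants proved by case analysis on `Step`. -/

theorem forall_setNode {s : State C n} {p : Fin n} {ns : NodeState C n}
    {R : Fin n → NodeState C n → Prop} (h : ∀ q, R q (s.node q)) (hp : R p ns) (q : Fin n) :
    R q ((s.setNode p ns).node q) := by
  by_cases hq : q = p
  · subst hq
    simpa [State.setNode] using hp
  · simpa [State.setNode, hq] using h q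

/-! ### Processing certificates -/

/-- A running delivery procedure of Deliver Condition 1 stays `φ` rounds behind its certificate. -/
def TasksBehind (P : Config n) (ns : NodeState C n) : Prop :=
  ∀ T ∈ ns.tasks, T.cond = .one → T.top + P.φ = T.start

theorem processCertificate_promises (ns : NodeState C n) (i : Fin n) (r : ℕ)
    (c : Cert (Msg C n)) : (processCertificate P ns i r c).promises = ns.promises := by
  unfold processCertificate
  split <;> rfl

theorem processCertificate_delivered (ns : NodeState C n) (i : Fin n) (r : ℕ)
    (c : Cert (Msg C n)) : (processCertificate P ns i r c).delivered = ns.delivered := by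
  unfold processCertificate
  split <;> rfl

theorem TasksBehind.insert_one {ns : NodeState C n} (h : TasksBehind P ns) (i : Fin n) (r : ℕ)
    (c : Cert (Msg C n)) : TasksBehind P (processCertificate P ns i r c) := by
  unfold processCertificate
  split
  · rintro T (rfl | hT) h1
    -- The guard `P.φ ≤ r` makes the truncated subtraction `r - P.φ` exact.
    · simp only
      omega
    · exact h T hT h1
  · exact h

/-- Processing `triggers[]` is a fold of calls of `processCertificate`, so whatever one call
preserves survives the whole fold. -/
theorem processTriggers_induction {R : NodeState C n → Prop}
    (hR : ∀ ns i r c, R ns → R (processCertificate P ns i r c)) (ns : NodeState C n)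
    (m : Msg C n) (h : R ns) : R (processTriggers P ns m) := by
  unfold processTriggers
  induction List.finRange n generalizing ns with
  | nil => exact h
  | cons j l ih =>
    rw [List.foldl_cons]
    apply ih
    split
    · exact h
    · exact hR _ _ _ _ h

theorem processTriggers_promises (ns : NodeState C n) (m : Msg C n) :
    (processTriggers P ns m).promises = ns.promises :=
  processTriggers_induction (R := fun x => x.promises = ns.promises)
    (fun _ _ _ _ h => (processCertificate_promises _ _ _ _).trans h) ns m rfl

theorem processTriggers_delivered (ns : NodeState C n) (m : Msg C n) :
    (processTriggers P ns m).delivered = ns.delivered :=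
  processTriggers_induction (R := fun x => x.delivered = ns.delivered)
    (fun _ _ _ _ h => (processCertificate_delivered _ _ _ _).trans h) ns m rfl

theorem TasksBehind.processTriggers {ns : NodeState C n} (h : TasksBehind P ns) (m : Msg C n) :
    TasksBehind P (processTriggers P ns m) :=
  processTriggers_induction (fun _ _ _ _ h => h.insert_one _ _ _) ns m h

/-! ### Monotonicity -/

/-- Signature shares are never lost, and the lists `promises` only grow at their ends. -/
structure State.Grows (s s' : State C n) : Prop where
  shares : s.shares ⊆ s'.shares
  promises : ∀ p i, (s.node p).promises i <+: (s'.node p).promises i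

theorem State.Grows.refl (s : State C n) : s.Grows s :=
  ⟨subset_rfl, fun _ _ => List.prefix_rfl⟩

theorem State.Grows.trans {s s' s'' : State C n} (h : s.Grows s') (h' : s'.Grows s'') :
    s.Grows s'' :=
  ⟨h.shares.trans h'.shares, fun p i => (h.promises p i).trans (h'.promises p i)⟩

theorem State.grows_setNode {s : State C n} {p : Fin n} {ns : NodeState C n}
    (h : ∀ i, (s.node p).promises i <+: ns.promises i) : s.Grows (s.setNode p ns) :=
  ⟨subset_rfl, forall_setNode (R := fun q ns => ∀ i, (s.node q).promises i <+: ns.promises i)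
    (fun _ _ => List.prefix_rfl) h⟩

theorem State.Grows.post {s s' : State C n} (h : s.Grows s') {A : Set (Packet C n)} :
    s.Grows (s'.post A) :=
  ⟨h.shares, h.promises⟩

theorem prefix_update_append (g : Fin n → List (Msg C n)) (j i : Fin n) (m : Msg C n) :
    g i <+: Function.update g j (g j ++ [m]) i := by
  by_cases h : i = j
  · subst h
    simp
  · simp [h]

theorem Step.grows {s s' : State C n} (h : Step P s s') : s.Grows s' := by
  cases h with
  | byzSend => exact ⟨subset_rfl, fun _ _ => List.prefix_rfl⟩
  | byzSign => exact ⟨Set.subset_insert _ _, fun _ _ => List.prefix_rfl⟩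
  | sendFirst => exact (State.grows_setNode (by exact fun _ => List.prefix_rfl)).post
  | sendNext => exact (State.grows_setNode (by exact fun _ => List.prefix_rfl)).post
  | receive => exact State.grows_setNode fun _ => List.prefix_rfl
  | sync => exact State.grows_setNode fun _ => prefix_update_append _ _ _ _
  | req => exact State.grows_setNode fun _ => prefix_update_append _ _ _ _
  | sign => exact ⟨Set.subset_insert _ _, fun _ _ => List.prefix_rfl⟩
  | request => exact ⟨subset_rfl, fun _ _ => List.prefix_rfl⟩
  | supply => exact ⟨subset_rfl, fun _ _ => List.prefix_rfl⟩
  | sendCert => exact ⟨subset_rfl, fun _ _ => List.prefix_rfl⟩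
  | startOne =>
    exact State.grows_setNode fun _ => by rw [processCertificate_promises]
  | startTwo => exact State.grows_setNode fun _ => List.prefix_rfl
  | startTwo' => exact State.grows_setNode fun _ => List.prefix_rfl
  | deliver =>
    exact State.grows_setNode fun _ => by rw [processTriggers_promises]

theorem IsExecution.grows {E : ℕ → State C n} (hE : IsExecution P E) {t t' : ℕ} (h : t ≤ t') :
    (E t).Grows (E t') := by
  induction t', h using Nat.le_induction with
  | base => exact .refl _
  | succ t' _ ih =>
    rcases hE.2 t' with h | h
    · rwa [h]
    · exact ih.trans h.grows

theorem CertValid.mono {s s' : State C n} {c : Cert (Msg C n)} (h : CertValid P s c)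
    (hs : s.shares ⊆ s'.shares) : CertValid P s' c := by
  obtain ⟨J, h1, h2, h3⟩ := h
  exact ⟨J, h1, h2, fun j hj => hs (h3 j hj)⟩

theorem IsExecution.induction {E : ℕ → State C n} (hE : IsExecution P E)
    {R : State C n → Prop} (h0 : R (State.init C n))
    (hstep : ∀ s s', Step P s s' → R s → R s') (t : ℕ) : R (E t) := by
  induction t with
  | zero => rw [hE.1]; exact h0
  | succ t ih =>
    rcases hE.2 t with h | h
    · rwa [h]
    · exact hstep _ _ h ih

/-! ### The lists `promises` -/

/-- Each entry of the list contains the certificate of the one before. -/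
def Linked (l : List (Msg C n)) : Prop :=
  ∀ k m, l[k + 1]? = some m → ∃ m', l[k]? = some m' ∧ m.prevCert = some ⟨m'⟩

theorem getElem?_of_prefix {α : Type*} {l l' : List α} (h : l <+: l') {k : ℕ} {a : α}
    (hk : l[k]? = some a) : l'[k]? = some a := by
  obtain ⟨l'', rfl⟩ := h
  rw [List.getElem?_append_left (List.getElem?_eq_some_iff.1 hk).1, hk]

theorem Linked.append {s : State C n} {l : List (Msg C n)} {m : Msg C n} (h : Linked l)
    (hnext : m.round = l.length + 1) (hext : Extends P s l m) : Linked (l ++ [m]) := by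
  intro k x hx
  by_cases hk : k + 1 < l.length
  · rw [List.getElem?_append_left hk] at hx
    obtain ⟨m', h1, h2⟩ := h k x hx
    exact ⟨m', getElem?_of_prefix (List.prefix_append _ _) h1, h2⟩
  · have hk' := (List.getElem?_eq_some_iff.1 hx).1
    simp only [List.length_append, List.length_singleton] at hk'
    have hk2 : k + 1 = l.length := by omega
    rw [hk2, List.getElem?_concat_length] at hx
    obtain rfl := Option.some.inj hx
    -- The new entry has round `l.length + 1 = k + 2`. This excludes the round-1 alternative of
    -- `Extends` and identifies the predecessor index `m.round - 2` with `k`.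
    rcases hext with h1 | ⟨-, m', h1, h2, -⟩
    · omega
    · rw [show m.round - 2 = k by omega] at h1
      exact ⟨m', getElem?_of_prefix (List.prefix_append _ _) h1, h2⟩

theorem linked_update_append {s : State C n} {g : Fin n → List (Msg C n)} {m : Msg C n}
    (h : ∀ i, Linked (g i)) (hnext : m.round = (g m.sender).length + 1)
    (hext : Extends P s (g m.sender) m) (i : Fin n) :
    Linked (Function.update g m.sender (g m.sender ++ [m]) i) := by
  by_cases hi : i = m.sender
  · subst hi
    simpa using (h m.sender).append hnext hext
  · simpa [hi] using h i

/-- Only `sync` and `req` alter `promises`, and both require `Extends` for the appended message. -/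
theorem Step.linked {s s' : State C n} (hs : Step P s s')
    (h : ∀ p i, Linked ((s.node p).promises i)) : ∀ p i, Linked ((s'.node p).promises i) := by
  have key {p : Fin n} {ns : NodeState C n} (hns : ∀ i, Linked (ns.promises i)) :
      ∀ q i, Linked (((s.setNode p ns).node q).promises i) :=
    forall_setNode (R := fun _ ns => ∀ i, Linked (ns.promises i)) h hns
  cases hs with
  | byzSend => exact h
  | byzSign => exact h
  | sendFirst p => exact key (h p)
  | sendNext p => exact key (h p)
  | receive p => exact key (h p)
  | sync p m m' hp hm' hsender hround hnext hext =>
    exact key (linked_update_append (h p) hnext hext)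
  | req p m hp hround hnext hext => exact key (linked_update_append (h p) hnext hext)
  | sign => exact h
  | request => exact h
  | supply => exact h
  | sendCert => exact h
  | startOne p => exact key (by rw [processCertificate_promises]; exact h p)
  | startTwo p => exact key (h p)
  | startTwo' p => exact key (h p)
  | deliver p => exact key (by rw [processTriggers_promises]; exact h p)

theorem IsExecution.linked {E : ℕ → State C n} (hE : IsExecution P E) (t : ℕ) (p i : Fin n) :
    Linked (((E t).node p).promises i) :=
  hE.induction (R := fun s => ∀ p i, Linked ((s.node p).promises i))
    (fun _ _ k m hm => by simp [State.init, NodeState.init] at hm)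
    (fun _ _ hs h => hs.linked h) t p i

/-! ### Signature shares of honest nodes -/

/-- An honest node that has signed a message for a round `r ≥ 2` stores the message of round
`r - 1` whose certificate it contains. -/
def SharesPromised (P : Config n) (s : State C n) : Prop :=
  ∀ p m, Honest P p → (p, m) ∈ s.shares → 2 ≤ m.round →
    ∃ m', ((s.node p).promises m.sender)[m.round - 2]? = some m' ∧ m.prevCert = some ⟨m'⟩

theorem SharesPromised.of_grows {s s' : State C n} (h : SharesPromised P s) (hg : s.Grows s')
    (hs : s'.shares = s.shares) : SharesPromised P s' := by
  intro p m hp hm hr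
  obtain ⟨m', h1, h2⟩ := h p m hp (hs ▸ hm) hr
  exact ⟨m', getElem?_of_prefix (hg.promises _ _) h1, h2⟩

/-- An honest share can arise only from `sign`, whose premise `Extends` provides the stored
predecessor; afterwards that entry stays at its index because lists only grow at their ends. -/
theorem Step.sharesPromised {s s' : State C n} (hs : Step P s s') (h : SharesPromised P s) :
    SharesPromised P s' := by
  have hg := hs.grows
  cases hs with
  | byzSign b m hb =>
    rintro p x hp (hx | hx) hr
    · obtain ⟨rfl, rfl⟩ := Prod.mk.inj hx
      exact absurd hp hb
    · exact h p x hp hx hr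
  | sign p m hp hm hext =>
    rintro q x hq (hx | hx) hr
    · obtain ⟨rfl, rfl⟩ := Prod.mk.inj hx
      rcases hext with h1 | ⟨-, m', h1, h2, -⟩
      · omega
      · exact ⟨m', h1, h2⟩
    · exact h q x hq hx hr
  | _ => exact h.of_grows hg rfl

theorem IsExecution.sharesPromised {E : ℕ → State C n} (hE : IsExecution P E) (t : ℕ) :
    SharesPromised P (E t) :=
  hE.induction (R := SharesPromised P) (fun _ _ _ hm => absurd hm (Set.notMem_empty _))
    (fun _ _ hs h => hs.sharesPromised h) t

/-- An honest node that signs a message of a chain stores every earlier message of the chain. -/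
theorem IsExecution.promises_of_signed {E : ℕ → State C n} (hE : IsExecution P E) {t : ℕ}
    {p i : Fin n} (hp : Honest P p) {r k : ℕ} {c : ℕ → Msg C n} (hr : 1 ≤ r) (hrk : r < k)
    (hi : (c k).sender = i) (hround : (c k).round = k)
    (hc : ∀ j, r < j → j ≤ k → (c j).prevCert = some ⟨c (j - 1)⟩)
    (hs : (p, c k) ∈ (E t).shares) : (((E t).node p).promises i)[r - 1]? = some (c r) := by
  -- Descent along the chain: `d` counts the rounds below `k - 1`, and the message of round `j` has
  -- index `j - 1`. The signature gives `d = 0`, and `Linked` gives each further step. The bound on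
  -- `d`, with `1 ≤ r`, keeps the subtractions exact.
  have key : ∀ d, d + r + 1 ≤ k →
      (((E t).node p).promises i)[k - 1 - d - 1]? = some (c (k - 1 - d)) := by
    intro d
    induction d with
    | zero =>
      intro _
      obtain ⟨m', h1, h2⟩ := hE.sharesPromised t p (c k) hp hs (by omega)
      rw [hc k hrk le_rfl] at h2
      simp only [Option.some.injEq, Cert.mk.injEq] at h2
      rw [hi, hround, ← h2] at h1
      exact h1
    | succ d ih =>
      intro hd
      have h := ih (by omega)
      rw [show k - 1 - d - 1 = k - 1 - (d + 1) - 1 + 1 by omega] at h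
      obtain ⟨m', h1, h2⟩ := hE.linked t p i _ _ h
      rw [hc (k - 1 - d) (by omega) (by omega)] at h2
      simp only [Option.some.injEq, Cert.mk.injEq] at h2
      rw [h1, ← h2]
      rfl
  have h := key (k - 1 - r) (by omega)
  rwa [show k - 1 - (k - 1 - r) = r by omega] at h

/-! ### Deliveries -/

theorem Step.tasksBehind {s s' : State C n} (hs : Step P s s')
    (h : ∀ p, TasksBehind P (s.node p)) : ∀ p, TasksBehind P (s'.node p) := by
  have key {p : Fin n} {ns : NodeState C n} (hns : TasksBehind P ns) :
      ∀ q, TasksBehind P ((s.setNode p ns).node q) :=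
    forall_setNode (R := fun _ ns => TasksBehind P ns) h hns
  -- Tasks of Deliver Condition 2 start at their own top round, but `TasksBehind` constrains only
  -- tasks of Condition 1.
  have two {p : Fin n} {T : Task C n} (hT : T.cond = .two) :
      TasksBehind P { s.node p with tasks := insert T (s.node p).tasks } := by
    rintro T' (rfl | hT') h1
    · rw [hT] at h1
      cases h1
    · exact h p T' hT' h1
  cases hs with
  | byzSend => exact h
  | byzSign => exact h
  | sendFirst p => exact key (h p)
  | sendNext p => exact key (h p)
  | receive p => exact key (h p)
  | sync p => exact key (h p)
  | req p => exact key (h p)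
  | sign => exact h
  | request => exact h
  | supply => exact h
  | sendCert => exact h
  | startOne p => exact key ((h p).insert_one _ _ _)
  | startTwo p => exact key (two rfl)
  | startTwo' p => exact key (two rfl)
  | deliver p => exact key (by apply TasksBehind.processTriggers; exact h p)

/-- `m` starts a chain of messages of `i` for the rounds `r, …, r + φ` that are certified in the
state `s`. -/
def StartsChain (P : Config n) (s : State C n) (i : Fin n) (r : ℕ) (m : Msg C n) : Prop :=
  1 ≤ r ∧ ∃ c : ℕ → Msg C n, c r = m ∧
    (∀ k, r ≤ k → k ≤ r + P.φ → (c k).sender = i ∧ (c k).round = k ∧ CertValid P s ⟨c k⟩) ∧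
    (∀ k, r < k → k ≤ r + P.φ → (c k).prevCert = some ⟨c (k - 1)⟩)

theorem StartsChain.mono {s s' : State C n} {i : Fin n} {r : ℕ} {m : Msg C n}
    (h : StartsChain P s i r m) (hs : s.shares ⊆ s'.shares) : StartsChain P s' i r m := by
  obtain ⟨hr, c, h1, h2, h3⟩ := h
  refine ⟨hr, c, h1, fun k hk hk' => ?_, h3⟩
  obtain ⟨ha, hb, hc⟩ := h2 k hk hk'
  exact ⟨ha, hb, hc.mono hs⟩

/-- Every message delivered by Deliver Condition 1 starts a certified chain over `φ` rounds. -/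
def DeliveredChained (P : Config n) (s : State C n) (ns : NodeState C n) : Prop :=
  ∀ i r m, (⟨.one, i, r, m⟩ : Delivery C n) ∈ ns.delivered → StartsChain P s i r m

theorem Step.deliveredChained {s s' : State C n} (hs : Step P s s')
    (hT : ∀ p, TasksBehind P (s.node p)) (h : ∀ p, DeliveredChained P s (s.node p)) :
    ∀ p, DeliveredChained P s' (s'.node p) := by
  -- Valid certificates stay valid as shares accumulate, so chains may be judged in the state before
  -- the step, where the walk takes place.
  suffices H : ∀ p, DeliveredChained P s (s'.node p) from
    fun p i r m hm => (H p i r m hm).mono hs.grows.shares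
  have key {p : Fin n} {ns : NodeState C n} (hns : DeliveredChained P s ns) :
      ∀ q, DeliveredChained P s ((s.setNode p ns).node q) :=
    forall_setNode (R := fun _ ns => DeliveredChained P s ns) h hns
  cases hs with
  | byzSend => exact h
  | byzSign => exact h
  | sendFirst p => exact key (h p)
  | sendNext p => exact key (h p)
  | receive p => exact key (h p)
  | sync p => exact key (h p)
  | req p => exact key (h p)
  | sign => exact h
  | request => exact h
  | supply => exact h
  | sendCert => exact h
  | startOne p => exact key fun i r m hm => h p i r m (by rwa [processCertificate_delivered] at hm)
  | startTwo p => exact key (h p)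
  | startTwo' p => exact key (h p)
  | deliver p T r c hp hTp hr hrT hwalk =>
    refine key fun i r' m hm => ?_
    rw [processTriggers_delivered] at hm
    rcases hm with hm | hm
    · obtain ⟨h1, rfl, rfl, rfl⟩ := Delivery.mk.inj hm
      -- With `r ≤ T.top` this yields `r + φ ≤ T.start`: the walk from `T.start` down to `r` covers
      -- all the rounds required.
      have hb := hT p T hTp h1.symm
      obtain ⟨-, h2, h3⟩ := hwalk
      refine ⟨hr, c, rfl, fun k hk hk' => ?_, fun k hk hk' => h3 k hk (by omega)⟩
      obtain ⟨ha, hb', hc, -⟩ := h2 k hk (by omega)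
      exact ⟨ha, hb', hc⟩
    · exact h p i r' m hm

/-- The two invariants are carried through one induction, since `Step.deliveredChained` needs
`TasksBehind` in the state before the step. -/
theorem IsExecution.startsChain_of_delivered {E : ℕ → State C n} (hE : IsExecution P E) {t : ℕ}
    {p i : Fin n} {r : ℕ} {m : Msg C n}
    (hm : (⟨.one, i, r, m⟩ : Delivery C n) ∈ ((E t).node p).delivered) :
    StartsChain P (E t) i r m :=
  (hE.induction
    (R := fun s => (∀ p, TasksBehind P (s.node p)) ∧ ∀ p, DeliveredChained P s (s.node p))
    ⟨fun _ _ hT => absurd hT (Set.notMem_empty _),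
      fun _ _ _ _ hm => absurd hm (Set.notMem_empty _)⟩
    (fun _ _ hs h => ⟨hs.tasksBehind h.1, hs.deliveredChained h.1 h.2⟩) t).2 p i r m hm

/-! ### Agreement -/

/-- At least `f + 1` honest nodes eventually store a message delivered by Deliver Condition 1. -/
theorem IsExecution.exists_honest_promises {E : ℕ → State C n} (hE : IsExecution P E)
    (hS : EnoughHonestSigners P E) {t : ℕ} {p i : Fin n} {r : ℕ} {m : Msg C n}
    (hm : (⟨.one, i, r, m⟩ : Delivery C n) ∈ ((E t).node p).delivered) :
    ∃ S : Finset (Fin n), P.f + 1 ≤ S.card ∧ ∀ q ∈ S, Honest P q ∧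
      ∃ t, (((E t).node q).promises i)[r - 1]? = some m := by
  obtain ⟨hr, c, rfl, h1, h2⟩ := hE.startsChain_of_delivered hm
  obtain ⟨S, hcard, hsign⟩ := hS i r c hr
    ⟨fun k hk hk' => ⟨(h1 k hk hk').1, (h1 k hk hk').2.1, t, (h1 k hk hk').2.2⟩, h2⟩
  refine ⟨S, hcard, fun q hq => ?_⟩
  obtain ⟨hq, k, hk, hk', t', ht'⟩ := hsign q hq
  obtain ⟨hi, hround, -⟩ := h1 k hk.le hk'
  exact ⟨hq, t', hE.promises_of_signed hq hr hk hi hround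
    (fun j hj hj' => h2 j hj (hj'.trans hk')) ht'⟩

/-- Two sets of `f + 1` honest nodes intersect if at most `2f + 1` nodes are honest. -/
theorem exists_mem_of_honest {S S' : Finset (Fin n)} (hn : n ≤ 2 * P.f + 1 + P.corrupt.card)
    (hS : P.f + 1 ≤ S.card) (hS' : P.f + 1 ≤ S'.card) (h : ∀ p ∈ S, Honest P p)
    (h' : ∀ p ∈ S', Honest P p) : ∃ p, p ∈ S ∧ p ∈ S' := by
  by_contra! hdisj
  have hd : Disjoint S S' := Finset.disjoint_left.2 hdisj
  -- Disjoint sets would give `2f + 2` nodes inside the complement of `P.corrupt`, which has at most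
  -- `2f + 1`.
  have hsub : S ∪ S' ⊆ P.corruptᶜ := by
    intro p hp
    rw [Finset.mem_compl]
    rcases Finset.mem_union.1 hp with hp | hp
    · exact h p hp
    · exact h' p hp
  have hcard := Finset.card_le_card hsub
  rw [Finset.card_union_of_disjoint hd, Finset.card_compl, Fintype.card_fin] at hcard
  omega

theorem IsExecution.agreementOne {E : ℕ → State C n} (hE : IsExecution P E)
    (hn : n ≤ 2 * P.f + 1 + P.corrupt.card) (hS : EnoughHonestSigners P E) :
    AgreementOne P E := by
  intro p q _ _ t t' i r m m' hm hm'
  obtain ⟨S, hcard, h⟩ := hE.exists_honest_promises hS hm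
  obtain ⟨S', hcard', h'⟩ := hE.exists_honest_promises hS hm'
  obtain ⟨x, hx, hx'⟩ := exists_mem_of_honest hn hcard hcard' (fun p hp => (h p hp).1)
    (fun p hp => (h' p hp).1)
  obtain ⟨-, u, hu⟩ := h x hx
  obtain ⟨-, u', hu'⟩ := h' x hx'
  -- The common node may have stored the two messages at different times `u` and `u'`; both entries
  -- are still present at the later one.
  have h1 := getElem?_of_prefix ((hE.grows (le_max_left u u')).promises x i) hu
  have h2 := getElem?_of_prefix ((hE.grows (le_max_right u u')).promises x i) hu'
  exact Option.some.inj (h1.symm.trans h2)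

end Protocol

theorem HoldsWithProb.mono {Ω : Type*} [MeasurableSpace Ω] {μ : Measure Ω} {a : ℝ}
    {A B : Ω → Prop} (h : HoldsWithProb μ a A) (hAB : ∀ ω, A ω → B ω) : HoldsWithProb μ a B := by
  obtain ⟨G, hG, ha, hA⟩ := h
  exact ⟨G, hG, ha, fun ω hω => hAB ω (hA ω hω)⟩

end APMBRB

theorem mainTheorem2 {C : Type*} (f nc φ : ℕ) (hash : List ℕ → ℕ)
    (corrupt : Finset (Fin (3 * f + 1))) (hcorrupt : corrupt.card = f)
    {Ω : Type*} [MeasurableSpace Ω] (μ : Measure Ω) [IsProbabilityMeasure μ]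
    (seed₀ : Ω → ℕ) (E : Ω → ℕ → APMBRB.State C (3 * f + 1))
    (hE : ∀ ω, APMBRB.IsExecution ⟨f, nc, φ, hash, seed₀ ω, corrupt⟩ (E ω)) :
    (∀ ω, APMBRB.HonestMajority ⟨f, nc, φ, hash, seed₀ ω, corrupt⟩ →
      APMBRB.EnoughHonestSigners ⟨f, nc, φ, hash, seed₀ ω, corrupt⟩ (E ω) →
      APMBRB.AgreementOne ⟨f, nc, φ, hash, seed₀ ω, corrupt⟩ (E ω)) ∧
    ∀ ε : ℝ,
      APMBRB.HoldsWithProb μ (1 - ε) (fun ω =>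
        APMBRB.HonestMajority ⟨f, nc, φ, hash, seed₀ ω, corrupt⟩ ∧
        APMBRB.EnoughHonestSigners ⟨f, nc, φ, hash, seed₀ ω, corrupt⟩ (E ω)) →
      APMBRB.HoldsWithProb μ (1 - ε) (fun ω =>
        APMBRB.AgreementOne ⟨f, nc, φ, hash, seed₀ ω, corrupt⟩ (E ω)) := by
  have key (ω : Ω) (hS : APMBRB.EnoughHonestSigners ⟨f, nc, φ, hash, seed₀ ω, corrupt⟩ (E ω)) :
      APMBRB.AgreementOne ⟨f, nc, φ, hash, seed₀ ω, corrupt⟩ (E ω) :=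
    -- The counting condition reads `3f + 1 ≤ 2f + 1 + f`.
    (hE ω).agreementOne (by simp only [hcorrupt]; omega) hS
  -- The implication holds for each `ω`, so the same event witnesses the probability bound.
  exact ⟨fun ω _ hS => key ω hS, fun ε h => h.mono fun ω hω => key ω hω.2⟩
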